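/- Let $\mathcal X,\mathcal Y,\mathcal Z$ be real Hilbert spaces, let $A:\mathcal X\to\mathcal Z$, $B:\mathcal Y\to\mathcal Z$ be continuous linear operators, $b\in\mathcal Z$, and let $f:\mathcal X\to\mathbb R\cup\{+\infty\}$, $g:\mathcal Y\to\mathbb R\cup\{+\infty\}$ be proper, convex and lower semicontinuous. Consider the problem $\min f(x)+g(y)$ subject to $Ax+By=b$, with solution set $\mathbb S$, and its Lagrangian $\mathcal L(x,y,\lambda)=f(x)+g(y)+\langle\lambda,Ax+By-b\rangle$. Let $\mu_f,\mu_g\ge 0$ be such that $f(x_1)-f(x_2)-\langle w,x_1-x_2\rangle\ge\frac{\mu_f}{2}\|x_1-x_2\|^2$ for all $x_1,x_2\in\mathcal X$ and $w\in\partial f(x_2)$, and likewise for $g$ with $\mu_g$ on $\mathcal Y$. Let $\gamma,\delta>0$, let $(\alpha_k)_{k\ge1}$ be a positive sequence, and let $(\beta_k)_{k\ge1}$ be a positive nondecreasing sequence with $\beta_k\to+\infty$, such that $\delta\gamma-1\ge0$ and, for every $k\ge1$, $$\delta\beta_{k+1}\le\delta\beta_k+\alpha_k\beta_k,\qquad \|B\|^2(\alpha_{k+1}^2\beta_{k+1}^2-\alpha_k^2\beta_k^2)\le\alpha_k\beta_k\mu_g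 .$$ Let $(\epsilon_k)_{k\ge1}$ be a nonincreasing real sequence with $\sum_{k\ge1}\alpha_k\epsilon_k<+\infty$ and $\lim_{k\to\infty}\beta_k\epsilon_k=+\infty$. Let $(x_k,y_k,\lambda_k)_{k\ge1}$ be generated as follows. Start from arbitrary $x_1=x_0=\frac1\gamma Z_1$, $y_1=y_0=\frac1\gamma H_1$, $\lambda_1=\lambda_0$. Put $Z_k^\delta=\delta Z_k+(1-\delta\gamma)x_k$ and $H_k^\delta=\delta H_k+(1-\delta\gamma)y_k$ for $k\ge1$. For $k=1,2,\dots$, with $\theta_k=(\alpha_k+\delta)\beta_k$, $\eta_{f,k}=\gamma+\frac1{\alpha_k}+\mu_f\delta\beta_k$ and $\eta_{g,k}=\gamma+\frac1{\alpha_k}+\mu_g\delta\beta_k$, let $$\widetilde\lambda_{1,k}=\lambda_k-\delta\beta_k(Ax_k+By_k-b)+\delta\alpha_k\beta_kB(H_k-\gamma y_k),\qquad \widetilde x_k=x_k+\tfrac{Z_k-\gamma x_k}{\eta_{f,k}},$$ $$x_{k+1}=\operatorname*{arg\,min}_{x\in\mathcal X}\Big(f(x)+\langle\widetilde\lambda_{1,k},Ax+By_k-b\rangle+\tfrac{\theta_k}2\|Ax+By_k-b\|^2+\tfrac{\eta_{f,k}}{2\alpha_k\beta_k}\|x-\widetilde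 x_k\|^2+\tfrac{\epsilon_k}2\|x\|^2\Big),$$ $$Z_{k+1}=\tfrac{x_{k+1}-x_k}{\alpha_k}+\gamma x_{k+1},$$ $$\widetilde\lambda_{2,k}=\lambda_k-\delta\beta_k(Ax_k+By_k-b),\qquad \widetilde y_k=y_k+\tfrac{H_k-\gamma y_k}{\eta_{g,k}},$$ $$y_{k+1}=\operatorname*{arg\,min}_{y\in\mathcal Y}\Big(g(y)+\langle\widetilde\lambda_{2,k},Ax_{k+1}+By-b\rangle+\tfrac{\theta_k}2\|Ax_{k+1}+By-b\|^2+\tfrac{\eta_{g,k}}{2\alpha_k\beta_k}\|y-\widetilde y_k\|^2+\tfrac{\epsilon_k}2\|y\|^2\Big),$$ $$H_{k+1}=\tfrac{y_{k+1}-y_k}{\alpha_k}+\gamma y_{k+1},\qquad \lambda_{k+1}=\lambda_k+\alpha_k\beta_k\big(AZ_{k+1}^\delta+BH_{k+1}^\delta-b\big).$$ Assume that $\mathcal L$ has a saddle point, i.e. there is $(x^*,y^*,\lambda^*)$ with $\mathcal L(x^*,y^*,\lambda)\le\mathcal L(x^*,y^*,\lambda^*)\le\mathcal L(x,y,\lambda^*)$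 for all $(x,y,\lambda)\in\mathcal X\times\mathcal Y\times\mathcal Z$, and let $(\bar x^*,\bar y^*)$ be the element of minimal norm of $\mathbb S$, where $\|(x,y)\|^2=\|x\|^2+\|y\|^2$. Then $$\liminf_{k\to+\infty}\|(x_k,y_k)-(\bar x^*,\bar y^*)\|=0 .$$ Further, if there is an integer $K\ge1$ such that the sequence $((x_k,y_k))_{k\ge K}$ stays in the open ball of $\mathcal X\times\mathcal Y$ with centre $0$ and radius $\sqrt{\|\bar x^*\|^2+\|\bar y^*\|^2}$, or stays in the complement of that ball, then $$\lim_{k\to+\infty}\|(x_k,y_k)-(\bar x^*,\bar y^*)\|=0 .$$ -/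

import Mathlib

open Filter Topology

namespace PrimalDual

variable {X Y Z : Type*}
  [NormedAddCommGroup X] [InnerProductSpace ℝ X]
  [NormedAddCommGroup Y] [InnerProductSpace ℝ Y]
  [NormedAddCommGroup Z] [InnerProductSpace ℝ Z]

/-- A function `f : X → ℝ ∪ {+∞}` (never `-∞`) that is finite somewhere. -/
def IsProper (f : X → EReal) : Prop :=
  (∀ u, f u ≠ ⊥) ∧ ∃ u, f u ≠ ⊤

/-- Convexity of a function with values in `ℝ ∪ {+∞}`. -/
def IsConvex (f : X → EReal) : Prop :=
  ∀ u v : X, ∀ s t : ℝ, 0 < s → 0 < t → s + t = 1 →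
    f (s • u + t • v) ≤ (s : EReal) * f u + (t : EReal) * f v

/-- The convex subdifferential `∂f(u) = {w | f(v) - f(u) ≥ ⟨w, v - u⟩ for all v}`. -/
def subdiff (f : X → EReal) (u : X) : Set X :=
  {w | ∀ v : X, f u + ((inner ℝ w (v - u) : ℝ) : EReal) ≤ f v}

/-- The class `S⁰_μ(X)`: proper, convex, lower semicontinuous functions satisfying the
subgradient inequality with the additional quadratic term `(μ/2)‖u₁ - u₂‖²`. -/
structure StrongClass (μ : ℝ) (f : X → EReal) : Prop where
  proper : IsProper f
  convex : IsConvex f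
  lsc : LowerSemicontinuous f
  strong : ∀ u₁ u₂ w : X, w ∈ subdiff f u₂ →
    f u₂ + ((inner ℝ w (u₁ - u₂) + μ / 2 * ‖u₁ - u₂‖ ^ 2 : ℝ) : EReal) ≤ f u₁

/-- The optimal solution set of `min f(u) + g(v)` subject to `A u + B v = b`. -/
def solutionSet (f : X → EReal) (g : Y → EReal) (A : X →L[ℝ] Z) (B : Y →L[ℝ] Z) (b : Z) :
    Set (X × Y) :=
  {p | A p.1 + B p.2 = b ∧
    ∀ u : X, ∀ v : Y, A u + B v = b → f p.1 + g p.2 ≤ f u + g v}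

/-- The Lagrangian `f(u) + g(v) + ⟨l, A u + B v - b⟩`. -/
noncomputable def lagrangian (f : X → EReal) (g : Y → EReal) (A : X →L[ℝ] Z) (B : Y →L[ℝ] Z)
    (b : Z) (u : X) (v : Y) (l : Z) : EReal :=
  f u + g v + ((inner ℝ l (A u + B v - b) : ℝ) : EReal)

/-- The augmented Lagrangian with penalty parameter `θ`. -/
noncomputable def augLagrangian (f : X → EReal) (g : Y → EReal) (A : X →L[ℝ] Z)
    (B : Y →L[ℝ] Z) (b : Z) (θ : ℝ) (u : X) (v : Y) (l : Z) : EReal :=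
  lagrangian f g A B b u v l + ((θ / 2 * ‖A u + B v - b‖ ^ 2 : ℝ) : EReal)

/-- `(u, v, l)` is a saddle point of the Lagrangian. -/
def IsSaddlePoint (f : X → EReal) (g : Y → EReal) (A : X →L[ℝ] Z) (B : Y →L[ℝ] Z) (b : Z)
    (u : X) (v : Y) (l : Z) : Prop :=
  (∀ l' : Z, lagrangian f g A B b u v l' ≤ lagrangian f g A B b u v l) ∧
  (∀ u' : X, ∀ v' : Y, lagrangian f g A B b u v l ≤ lagrangian f g A B b u' v' l)

/-- `(u, v)` as an element of the product Hilbert space, `‖(u, v)‖² = ‖u‖² + ‖v‖²`. -/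
noncomputable def pair (u : X) (v : Y) : WithLp 2 (X × Y) := WithLp.toLp 2 (u, v)

/-- `(u, v)` is the solution of minimal norm, i.e. the projection of `0` onto the
solution set. -/
def IsMinNormSolution (f : X → EReal) (g : Y → EReal) (A : X →L[ℝ] Z) (B : Y →L[ℝ] Z) (b : Z)
    (u : X) (v : Y) : Prop :=
  (u, v) ∈ solutionSet f g A B b ∧
  ∀ q ∈ solutionSet f g A B b, ‖pair u v‖ ≤ ‖pair q.1 q.2‖

/-- The number `η = γ + 1/α + μ δ β`. -/
noncomputable def eta (γ δ μ α β : ℝ) : ℝ := γ + 1 / α + μ * δ * β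

/-- The sequences `x, y, lam` (with auxiliary sequences `V, H` and `Vd, Hd`, the latter
playing the role of `V^δ, H^δ`) are generated by the primal-dual splitting algorithm with step
sizes `α`, time scales `β` and Tikhonov parameters `ε`. All sequences are meant for indices
`k ≥ 1`, except that `x, y, lam` also have an index-`0` value, equal to the initial value.

In each of the two minimization steps the summand of the augmented Lagrangian that does not
depend on the minimization variable (`g (y k)`, respectively `f (x (k+1))`) is an additive
constant and is left out, so that the subproblem keeps its meaning also when the starting point
is outside the domain of `g`. -/
structure IsSplittingSequence (f : X → EReal) (g : Y → EReal) (A : X →L[ℝ] Z)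
    (B : Y →L[ℝ] Z) (b : Z) (μf μg γ δ : ℝ) (α β ε : ℕ → ℝ)
    (x : ℕ → X) (y : ℕ → Y) (lam : ℕ → Z)
    (V Vd : ℕ → X) (H Hd : ℕ → Y) : Prop where
  init_x : x 1 = x 0 ∧ x 0 = (1 / γ) • V 1
  init_y : y 1 = y 0 ∧ y 0 = (1 / γ) • H 1
  init_lam : lam 1 = lam 0
  step_x : ∀ k : ℕ, 1 ≤ k →
    IsMinOn (fun u : X =>
      augLagrangian f (fun _ => 0) A B b ((α k + δ) * β k) u (y k)
          (lam k - (δ * β k) • (A (x k) + B (y k) - b)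
            + (δ * α k * β k) • B (H k - γ • y k))
        + ((eta γ δ μf (α k) (β k) / (2 * α k * β k)
              * ‖u - (x k + (1 / eta γ δ μf (α k) (β k)) • (V k - γ • x k))‖ ^ 2
            + ε k / 2 * ‖u‖ ^ 2 : ℝ) : EReal))
      Set.univ (x (k + 1))
  step_V : ∀ k : ℕ, 1 ≤ k →
    V (k + 1) = (1 / α k) • (x (k + 1) - x k) + γ • x (k + 1)
  def_Vd : ∀ k : ℕ, 1 ≤ k → Vd k = δ • V k + (1 - δ * γ) • x k
  step_y : ∀ k : ℕ, 1 ≤ k →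
    IsMinOn (fun v : Y =>
      augLagrangian (fun _ => 0) g A B b ((α k + δ) * β k) (x (k + 1)) v
          (lam k - (δ * β k) • (A (x k) + B (y k) - b))
        + ((eta γ δ μg (α k) (β k) / (2 * α k * β k)
              * ‖v - (y k + (1 / eta γ δ μg (α k) (β k)) • (H k - γ • y k))‖ ^ 2
            + ε k / 2 * ‖v‖ ^ 2 : ℝ) : EReal))
      Set.univ (y (k + 1))
  step_H : ∀ k : ℕ, 1 ≤ k →
    H (k + 1) = (1 / α k) • (y (k + 1) - y k) + γ • y (k + 1)
  def_Hd : ∀ k : ℕ, 1 ≤ k → Hd k = δ • H k + (1 - δ * γ) • y k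
  step_lam : ∀ k : ℕ, 1 ≤ k →
    lam (k + 1) = lam k + (α k * β k) • (A (Vd (k + 1)) + B (Hd (k + 1)) - b)

end PrimalDual

/-!
The argument is a Lyapunov analysis followed by a strong convergence argument based on minimal norms.
Write `F` for the Lagrangian gap `L(x, y, ls) - L(xbar, ybar, ls) ≥ 0` (`lagrangianGap`) and `N` for
`‖x‖² + ‖y‖²`, with value `Ns` at the minimal norm solution `(xbar, ybar)`; by
`IsSaddlePoint.of_mem_solutionSet` the multiplier `ls` of any saddle point also belongs to
`(xbar, ybar)`.

The optimality conditions of the two proximal subproblems (`subproblem_optimality`) turn the scheme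
into a discretized inertial system. The first block only sees the multiplier
`lam (k + 1) + α β B (Hd k - Hd (k + 1))`, and the resulting mixed term telescopes against the dual
update (`dual_energy_step`). With the quadratic energy `Q` this gives, in
`IsSplittingSequence.energy_step`,
`Q⁺ + (δ α β + δ² β) (F⁺ + ε/2 (N⁺ - Ns)) ≤ Q + δ² β (F + ε/2 (N - Ns))`.

Two consequences are drawn. Moving `Ns` to the right, the energy grows by at most a multiple of
`α β ε`; as `∑ α ε < ∞`, Kronecker's argument (`tendsto_div_zero_of_add_le`) shows that it is
`o(β)`. So `F → 0`, the multipliers are `O(√β)`, and the residuals `A x + B y - b` tend to `0`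
(`tendsto_residual`). If on the other hand `N ≥ Ns` eventually, then the energy including
`δ² β (F + ε/2 (N - Ns))` is nonincreasing, and `β ε → ∞` forces `N → Ns`
(`norm_sq_upper_bound_of_outside`).

Points with `F → 0`, vanishing residual and `limsup N ≤ Ns` converge strongly to `(xbar, ybar)`
(`tendsto_minNormSolution`): they enter nested closed convex sets whose intersection is the solution
set, and the minimal norms over these sets increase to that over the intersection, so the
parallelogram law applies. If `N ≥ Ns` eventually, or `N < Ns` eventually, this gives convergence of
the whole sequence; in the remaining case it gives convergence along the indices with `N < Ns`.
-/

namespace PrimalDual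

/-! ### Approximate solutions of small norm -/

theorem norm_sub_sq_le_of_midpoint {E : Type*} [NormedAddCommGroup E] [InnerProductSpace ℝ E]
    {C : Set E} (hC : Convex ℝ C) {u v : E} (hu : u ∈ C) (hv : v ∈ C) {m : ℝ}
    (hm : ∀ w ∈ C, m ≤ ‖w‖ ^ 2) : ‖u - v‖ ^ 2 ≤ 2 * ‖u‖ ^ 2 + 2 * ‖v‖ ^ 2 - 4 * m := by
  have h1 := hm _ (hC hu hv (by norm_num : (0 : ℝ) ≤ 1 / 2) (by norm_num : (0 : ℝ) ≤ 1 / 2)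
    (by norm_num))
  rw [← smul_add, norm_smul, mul_pow] at h1
  have h2 := parallelogram_law_with_norm ℝ u v
  norm_num at h1
  nlinarith

/-- The minimal norms over nested closed convex sets increase to the minimal norm over the
intersection: the projections of `0` form a Cauchy sequence by the parallelogram law. -/
theorem norm_sq_lower_bound_of_antitone {E : Type*} [NormedAddCommGroup E]
    [InnerProductSpace ℝ E] [CompleteSpace E] {C : ℕ → Set E} (hanti : Antitone C)
    (hcl : ∀ n, IsClosed (C n)) (hconv : ∀ n, Convex ℝ (C n)) {z : E} (hzC : ∀ n, z ∈ C n)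
    (hz : ∀ q, (∀ n, q ∈ C n) → ‖z‖ ≤ ‖q‖) {τ : ℝ} (hτ : 0 < τ) :
    ∃ n, ∀ u ∈ C n, ‖z‖ ^ 2 - τ ≤ ‖u‖ ^ 2 := by
  have hex : ∀ n, ∃ p ∈ C n, ∀ u ∈ C n, ‖p‖ ≤ ‖u‖ := by
    intro n
    obtain ⟨p, hp, he⟩ := exists_norm_eq_iInf_of_complete_convex ⟨z, hzC n⟩
      (hcl n).isComplete (hconv n) (0 : E)
    refine ⟨p, hp, fun u hu => ?_⟩
    have : (⨅ w : C n, ‖(0 : E) - w‖) ≤ ‖(0 : E) - u‖ :=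
      ciInf_le (f := fun w : C n => ‖(0 : E) - w‖)
        ⟨0, by rintro _ ⟨w, rfl⟩; exact norm_nonneg _⟩ ⟨u, hu⟩
    rw [← he] at this
    simpa using this
  choose p hp hmin using hex
  have hmin2 : ∀ n, ∀ u ∈ C n, ‖p n‖ ^ 2 ≤ ‖u‖ ^ 2 := fun n u hu =>
    pow_le_pow_left₀ (norm_nonneg _) (hmin n u hu) 2
  have hmono : Monotone fun n => ‖p n‖ ^ 2 := fun n m h => hmin2 n _ (hanti h (hp m))
  have hbdd : BddAbove (Set.range fun n => ‖p n‖ ^ 2) :=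
    ⟨‖z‖ ^ 2, by rintro _ ⟨n, rfl⟩; exact hmin2 n z (hzC n)⟩
  have hlim := tendsto_atTop_ciSup hmono hbdd
  have hcau : CauchySeq p := by
    rw [Metric.cauchySeq_iff']
    intro e he
    obtain ⟨n, hn⟩ := ((Metric.cauchySeq_iff'.1 hlim.cauchySeq) (e ^ 2 / 2) (by positivity))
    refine ⟨n, fun m hm => ?_⟩
    have h1 := norm_sub_sq_le_of_midpoint (hconv n) (hanti hm (hp m)) (hp n) (hmin2 n)
    have h2 := hn m hm
    rw [Real.dist_eq, abs_lt] at h2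
    rw [dist_eq_norm]
    exact lt_of_pow_lt_pow_left₀ 2 he.le (by linarith [h2.2])
  obtain ⟨q, hq⟩ := cauchySeq_tendsto_of_complete hcau
  have hqC : ∀ n, q ∈ C n := fun n => (hcl n).mem_of_tendsto hq
    ((eventually_ge_atTop n).mono fun m hm => hanti hm (hp m))
  have h1 : Tendsto (fun n => ‖p n‖ ^ 2) atTop (𝓝 (‖q‖ ^ 2)) := hq.norm.pow 2
  have h2 : ‖z‖ ^ 2 - τ < ‖q‖ ^ 2 := by
    have := pow_le_pow_left₀ (norm_nonneg _) (hz q hqC) 2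
    linarith
  obtain ⟨n, hn⟩ := (h1.eventually (lt_mem_nhds h2)).exists
  exact ⟨n, fun u hu => hn.le.trans (hmin2 n u hu)⟩

/-- A substitute for weak compactness: a family that is eventually in each of the nested closed
convex sets `C n`, and whose norms are asymptotically at most that of the minimal norm element `z`
of `⋂ n, C n`, converges strongly to `z`. -/
theorem tendsto_min_norm_of_antitone {E ι : Type*} [NormedAddCommGroup E]
    [InnerProductSpace ℝ E] [CompleteSpace E] {C : ℕ → Set E} (hanti : Antitone C)
    (hcl : ∀ n, IsClosed (C n)) (hconv : ∀ n, Convex ℝ (C n)) {z : E} (hzC : ∀ n, z ∈ C n)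
    (hz : ∀ q, (∀ n, q ∈ C n) → ‖z‖ ≤ ‖q‖) {l : Filter ι} {u : ι → E}
    (hu : ∀ n, ∀ᶠ k in l, u k ∈ C n)
    (hN : ∀ τ > 0, ∀ᶠ k in l, ‖u k‖ ^ 2 ≤ ‖z‖ ^ 2 + τ) : Tendsto u l (𝓝 z) := by
  rw [Metric.tendsto_nhds]
  intro e he
  have hτ : 0 < e ^ 2 / 7 := by positivity
  obtain ⟨n, hn⟩ := norm_sq_lower_bound_of_antitone hanti hcl hconv hzC hz hτ
  filter_upwards [hu n, hN _ hτ] with k hk hk'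
  have h1 := norm_sub_sq_le_of_midpoint (hconv n) hk (hzC n) hn
  rw [dist_eq_norm]
  exact lt_of_pow_lt_pow_left₀ 2 he.le (by nlinarith [sq_pos_of_pos he])

/-! ### Scalar and vector recursions -/

/-- A form of Kronecker's lemma: increments `a k * β k` with summable `a` and `β` increasing to
infinity only produce growth of order `o(β)`. -/
theorem tendsto_div_zero_of_add_le {a β e : ℕ → ℝ} (ha0 : ∀ k, 0 ≤ a k) (ha : Summable a)
    (hβ0 : ∀ k, 0 < β k) (hβm : Monotone β) (hβ : Tendsto β atTop atTop)
    (he0 : ∀ k, 0 ≤ e k) (he : ∀ k, e (k + 1) ≤ e k + a k * β k) :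
    Tendsto (fun k => e k / β k) atTop (𝓝 0) := by
  rw [Metric.tendsto_nhds]
  intro η hη
  obtain ⟨m, hm⟩ := ((tendsto_sum_nat_add a).eventually (gt_mem_nhds (half_pos hη))).exists
  have hbound : ∀ n, e (n + m) ≤ e m + (∑ j ∈ Finset.range n, a (j + m)) * β (n + m) := by
    intro n
    induction n with
    | zero => simp
    | succ n ih =>
      rw [Finset.sum_range_succ, show n + 1 + m = n + m + 1 by ring]
      have h1 := he (n + m)
      have h2 : 0 ≤ ∑ j ∈ Finset.range n, a (j + m) := Finset.sum_nonneg fun j _ => ha0 _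
      have h3 := mul_le_mul_of_nonneg_left (hβm (Nat.le_succ (n + m))) (add_nonneg h2 (ha0 (n + m)))
      simp only [Nat.succ_eq_add_one] at h3
      linarith
  have hsum : ∀ n, ∑ j ∈ Finset.range n, a (j + m) ≤ η / 2 := fun n =>
    (((summable_nat_add_iff m).2 ha).sum_le_tsum _ fun j _ => ha0 _).trans hm.le
  have h0 : Tendsto (fun k => e m / β k) atTop (𝓝 0) := tendsto_const_nhds.div_atTop hβ
  filter_upwards [h0.eventually (gt_mem_nhds (half_pos hη)), eventually_ge_atTop m] with k hk hkm
  obtain ⟨n, rfl⟩ := Nat.exists_eq_add_of_le' hkm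
  rw [Real.dist_0_eq_abs, abs_of_nonneg (div_nonneg (he0 _) (hβ0 _).le), div_lt_iff₀ (hβ0 _)]
  rw [div_lt_iff₀ (hβ0 _)] at hk
  have := mul_le_mul_of_nonneg_right (hsum n) (hβ0 (n + m)).le
  linarith [hbound n]

/-- If the dual iterates grow at most like `√β`, then the constraint residuals vanish. The change of
variable `ρ k = r k - (1 / (δ * β k)) • l k` turns the differences of `l` into an absolutely
controlled perturbation, since `β k * (α k + δ) ≥ δ * β (k + 1)`. -/
theorem tendsto_residual {E : Type*} [NormedAddCommGroup E] [NormedSpace ℝ E] {r l : ℕ → E}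
    {α β : ℕ → ℝ} {δ M : ℝ} (hδ : 0 < δ) (hα : ∀ k, 0 < α k) (hβ0 : ∀ k, 0 < β k)
    (hβm : Monotone β) (hβ : Tendsto β atTop atTop)
    (hgrow : ∀ k, δ * β (k + 1) ≤ δ * β k + α k * β k)
    (hl : ∀ k, ‖l k‖ ≤ M * √(β k))
    (hr : ∀ k, ((α k + δ) * β k) • r (k + 1) = (δ * β k) • r k + (l (k + 1) - l k)) :
    Tendsto r atTop (𝓝 0) := by
  have hM : 0 ≤ M := by
    have h1 := (norm_nonneg _).trans (hl 0)
    exact nonneg_of_mul_nonneg_left h1 (Real.sqrt_pos.2 (hβ0 0))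
  set ρ : ℕ → E := fun k => r k - (1 / (δ * β k)) • l k with hρ
  have hρ1 : ∀ k, ρ (k + 1) = (δ / (α k + δ)) • ρ k
      - (1 / (δ * β (k + 1)) - 1 / ((α k + δ) * β k)) • l (k + 1) := by
    intro k
    have h1 := hα k
    have h2 := hβ0 k
    have h3 := hβ0 (k + 1)
    have h4 : 0 < α k + δ := by positivity
    have hrk : r (k + 1) = (1 / ((α k + δ) * β k)) • ((δ * β k) • r k + (l (k + 1) - l k)) := by
      rw [← hr k, smul_smul, one_div_mul_cancel (by positivity), one_smul]
    simp only [hρ]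
    rw [hrk]
    match_scalars <;> field_simp
    ring
  -- The first lower bound on `D` makes the bound on `‖ρ k‖ * √(β k)` propagate.
  obtain ⟨D, hD1, hD2⟩ : ∃ D, M / δ ≤ D ∧ ‖ρ 0‖ * √(β 0) ≤ D :=
    ⟨_, le_max_left _ _, le_max_right _ _⟩
  have hD0 : 0 ≤ D := (div_nonneg hM hδ.le).trans hD1
  have hbd : ∀ k, ‖ρ k‖ * √(β k) ≤ D := by
    intro k
    induction k with
    | zero => exact hD2
    | succ k ih =>
      have h1 := hα k
      have h2 := hβ0 k
      have h3 := hβ0 (k + 1)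
      have h4 : 0 < α k + δ := by positivity
      have hc : 0 ≤ 1 / (δ * β (k + 1)) - 1 / ((α k + δ) * β k) := by
        rw [sub_nonneg]
        apply one_div_le_one_div_of_le (by positivity)
        linarith [hgrow k]
      have hn : ‖ρ (k + 1)‖ ≤ (δ / (α k + δ)) * ‖ρ k‖
          + (1 / (δ * β (k + 1)) - 1 / ((α k + δ) * β k)) * (M * √(β (k + 1))) := by
        rw [hρ1 k]
        refine (norm_sub_le _ _).trans ?_
        rw [norm_smul, norm_smul, Real.norm_of_nonneg hc, Real.norm_of_nonneg (by positivity)]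
        gcongr
        exact hl _
      set s := √(β k)
      set s' := √(β (k + 1))
      have hs : 0 < s := Real.sqrt_pos.2 h2
      have hs' : 0 < s' := Real.sqrt_pos.2 h3
      have hss : s ≤ s' := Real.sqrt_le_sqrt (hβm (Nat.le_succ k))
      have hsq : β k = s ^ 2 := (Real.sq_sqrt h2.le).symm
      have hsq' : β (k + 1) = s' ^ 2 := (Real.sq_sqrt h3.le).symm
      have hgk := hgrow k
      rw [hsq, hsq'] at hgk hn
      have ih' : ‖ρ k‖ ≤ D / s := (le_div_iff₀ hs).2 ih
      -- `t` is the contraction factor after the rescaling by `β`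
      set t := δ * s' ^ 2 / ((α k + δ) * s ^ 2) with ht
      have ht0 : 0 ≤ t := by positivity
      have ht1 : t ≤ 1 := by
        rw [ht, div_le_one (by positivity)]; linarith
      have e2 : (1 / (δ * s' ^ 2) - 1 / ((α k + δ) * s ^ 2)) * (M * s') * s'
          = (1 - t) * (M / δ) := by
        rw [ht]; field_simp
      have e1 : (δ / (α k + δ)) * (D / s) * s' = t * (s / s') * D := by
        rw [ht]; field_simp
      have hs1 : s / s' ≤ 1 := (div_le_one hs').2 hss
      calc ‖ρ (k + 1)‖ * s' ≤ ((δ / (α k + δ)) * (D / s)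
          + (1 / (δ * s' ^ 2) - 1 / ((α k + δ) * s ^ 2)) * (M * s')) * s' := by
            gcongr
            refine hn.trans ?_
            gcongr
        _ = t * (s / s') * D + (1 - t) * (M / δ) := by rw [add_mul, e1, e2]
        _ ≤ t * 1 * D + (1 - t) * D := by
            have : 0 ≤ 1 - t := by linarith
            gcongr
        _ = D := by ring
  have hfin : ∀ k, ‖r k‖ ≤ (D + M / δ) / √(β k) := by
    intro k
    have h2 := hβ0 k
    have hs : 0 < √(β k) := Real.sqrt_pos.2 h2
    have e : r k = ρ k + (1 / (δ * β k)) • l k := by simp [hρ]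
    rw [e, le_div_iff₀ hs]
    have h5 : ‖(1 / (δ * β k)) • l k‖ * √(β k) ≤ M / δ := by
      rw [norm_smul, Real.norm_of_nonneg (by positivity)]
      calc 1 / (δ * β k) * ‖l k‖ * √(β k) ≤ 1 / (δ * β k) * (M * √(β k)) * √(β k) := by
            gcongr; exact hl k
        _ = M / δ := by
            rw [show 1 / (δ * β k) * (M * √(β k)) * √(β k) = 1 / (δ * β k) * M * (√(β k) * √(β k))
              by ring, Real.mul_self_sqrt h2.le]
            field_simp
    calc _ ≤ (‖ρ k‖ + ‖(1 / (δ * β k)) • l k‖) * √(β k) := by gcongr; exact norm_add_le _ _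
      _ ≤ _ := by rw [add_mul]; exact add_le_add (hbd k) h5
  exact squeeze_zero_norm hfin
    (tendsto_const_nhds.div_atTop (Real.tendsto_sqrt_atTop.comp hβ))

/-! ### Extended real valued convex functions -/

theorem IsProper.exists_coe {X : Type*} [NormedAddCommGroup X] [InnerProductSpace ℝ X]
    {f : X → EReal} (hf : IsProper f) {u : X} (hu : f u ≠ ⊤) : ∃ a : ℝ, f u = a :=
  ⟨(f u).toReal, (EReal.coe_toReal hu (hf.1 u)).symm⟩

theorem ne_top_and_ne_top_of_add_le {a b : EReal} (ha : a ≠ ⊥) (hb : b ≠ ⊥) {r c : ℝ}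
    (h : a + b + (r : EReal) ≤ c) : a ≠ ⊤ ∧ b ≠ ⊤ := by
  rw [← EReal.add_ne_top_iff_ne_top₂ ha hb]
  intro htop
  rw [htop, EReal.top_add_coe, top_le_iff] at h
  exact EReal.coe_ne_top _ h

/-- Fermat's rule for a convex function plus a real function `q` that is quadratic along lines
through the minimizer `p`, with gradient `G` there. -/
theorem neg_mem_subdiff_of_isMin {X : Type*} [NormedAddCommGroup X] [InnerProductSpace ℝ X]
    {f : X → EReal} (hp : IsProper f) (hc : IsConvex f) {q : X → ℝ} {p G : X}
    (hmin : ∀ u, f p + (q p : EReal) ≤ f u + (q u : EReal))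
    (hq : ∀ d, ∃ c : ℝ, ∀ t : ℝ, q (p + t • d) = q p + t * inner ℝ G d + t ^ 2 * c) :
    f p ≠ ⊤ ∧ -G ∈ subdiff f p := by
  have hfin : f p ≠ ⊤ := by
    intro htop
    obtain ⟨u, hu⟩ := hp.2
    obtain ⟨a, ha⟩ := hp.exists_coe hu
    have := hmin u
    rw [htop, EReal.top_add_coe, top_le_iff, ha, ← EReal.coe_add] at this
    exact EReal.coe_ne_top _ this
  refine ⟨hfin, fun v => ?_⟩
  by_cases hv : f v = ⊤
  · rw [hv]; exact le_top
  obtain ⟨a, ha⟩ := hp.exists_coe hfin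
  obtain ⟨b, hb⟩ := hp.exists_coe hv
  rw [ha, hb, ← EReal.coe_add, EReal.coe_le_coe_iff, inner_neg_left]
  obtain ⟨c, hc'⟩ := hq (v - p)
  have key : ∀ t : ℝ, 0 < t → t < 1 → a ≤ b + inner ℝ G (v - p) + t * c := by
    intro t ht0 ht1
    have h1 := hmin (p + t • (v - p))
    have h2 := hc v p t (1 - t) ht0 (by linarith) (by ring)
    rw [show t • v + (1 - t) • p = p + t • (v - p) by module, ha, hb, ← EReal.coe_mul,
      ← EReal.coe_mul, ← EReal.coe_add] at h2
    have h3 : f (p + t • (v - p)) ≠ ⊤ := ne_top_of_le_ne_top (EReal.coe_ne_top _) h2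
    obtain ⟨e, he⟩ := hp.exists_coe h3
    rw [ha, he, ← EReal.coe_add, ← EReal.coe_add, EReal.coe_le_coe_iff, hc'] at h1
    rw [he, EReal.coe_le_coe_iff] at h2
    have h4 : t * a ≤ t * (b + inner ℝ G (v - p) + t * c) := by nlinarith
    exact le_of_mul_le_mul_left h4 ht0
  have hlim : Tendsto (fun t : ℝ => b + inner ℝ G (v - p) + t * c) (𝓝[>] 0)
      (𝓝 (b + inner ℝ G (v - p) + 0 * c)) :=
    ((continuous_const.add (continuous_id.mul continuous_const)).tendsto 0).mono_left
      nhdsWithin_le_nhds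
  have := ge_of_tendsto hlim (by
    filter_upwards [Ioo_mem_nhdsGT (zero_lt_one' ℝ)] with t ht using key t ht.1 ht.2)
  linarith

theorem StrongClass.toReal_le {X : Type*} [NormedAddCommGroup X] [InnerProductSpace ℝ X]
    {μ : ℝ} {f : X → EReal} (hf : StrongClass μ f) {p u w : X} (hw : w ∈ subdiff f p)
    (hp : f p ≠ ⊤) (hu : f u ≠ ⊤) :
    (f p).toReal + inner ℝ w (u - p) + μ / 2 * ‖u - p‖ ^ 2 ≤ (f u).toReal := by
  obtain ⟨a, ha⟩ := hf.proper.exists_coe hp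
  obtain ⟨b, hb⟩ := hf.proper.exists_coe hu
  have := hf.strong u p w hw
  rw [ha, hb, ← EReal.coe_add, EReal.coe_le_coe_iff] at this
  simp only [ha, hb, EReal.toReal_coe]
  linarith

/-- The optimality condition of the proximal subproblems of the algorithm, in one variable. The
centre of the proximal term is `w`, its weight `κ`. -/
theorem subproblem_optimality {X Z : Type*} [NormedAddCommGroup X] [InnerProductSpace ℝ X]
    [CompleteSpace X] [NormedAddCommGroup Z] [InnerProductSpace ℝ Z] [CompleteSpace Z]
    {f : X → EReal} (hp : IsProper f) (hc : IsConvex f) (A : X →L[ℝ] Z) {l c : Z} {θ κ ε : ℝ}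
    {w p : X}
    (hmin : ∀ u, f p + ((inner ℝ l (A p + c) + θ / 2 * ‖A p + c‖ ^ 2
        + (κ / 2 * ‖p - w‖ ^ 2 + ε / 2 * ‖p‖ ^ 2) : ℝ) : EReal)
      ≤ f u + ((inner ℝ l (A u + c) + θ / 2 * ‖A u + c‖ ^ 2
        + (κ / 2 * ‖u - w‖ ^ 2 + ε / 2 * ‖u‖ ^ 2) : ℝ) : EReal)) :
    f p ≠ ⊤ ∧ -(ContinuousLinearMap.adjoint A (l + θ • (A p + c)) + κ • (p - w) + ε • p)
      ∈ subdiff f p := by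
  refine neg_mem_subdiff_of_isMin hp hc
    (q := fun u => inner ℝ l (A u + c) + θ / 2 * ‖A u + c‖ ^ 2
        + (κ / 2 * ‖u - w‖ ^ 2 + ε / 2 * ‖u‖ ^ 2)) hmin fun d => ?_
  refine ⟨θ / 2 * ‖A d‖ ^ 2 + κ / 2 * ‖d‖ ^ 2 + ε / 2 * ‖d‖ ^ 2, fun t => ?_⟩
  have e1 : A (p + t • d) + c = (A p + c) + t • A d := by
    rw [map_add, map_smul]; abel
  have e2 : p + t • d - w = (p - w) + t • d := by abel
  simp only [e1, e2, inner_add_left, inner_add_right, inner_smul_left, inner_smul_right,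
    ContinuousLinearMap.adjoint_inner_left, norm_add_sq_real, norm_smul, mul_pow, Real.norm_eq_abs,
    sq_abs, RCLike.conj_to_real]
  ring

/-! ### Saddle points and sublevel sets of the Lagrangian -/

theorem norm_pair_sq {X Y : Type*} [NormedAddCommGroup X] [NormedAddCommGroup Y] (u : X) (v : Y) :
    ‖pair u v‖ ^ 2 = ‖u‖ ^ 2 + ‖v‖ ^ 2 := by
  simp [pair, WithLp.prod_norm_sq_eq_of_L2]

section Saddle

variable {X Y Z : Type*}
  [NormedAddCommGroup X] [InnerProductSpace ℝ X]
  [NormedAddCommGroup Y] [InnerProductSpace ℝ Y]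
  [NormedAddCommGroup Z] [InnerProductSpace ℝ Z]
  {f : X → EReal} {g : Y → EReal} {A : X →L[ℝ] Z} {B : Y →L[ℝ] Z} {b : Z}

theorem lagrangian_of_feasible {u : X} {v : Y} (h : A u + B v = b) (l : Z) :
    lagrangian f g A B b u v l = f u + g v := by
  simp [lagrangian, h]

/-- Every solution `p` is, together with the multiplier of a given saddle point, again a saddle
point; moreover the objective is finite at `p`. -/
theorem IsSaddlePoint.of_mem_solutionSet (hf : IsProper f) (hg : IsProper g) {u : X} {v : Y} {l : Z}
    (hΩ : IsSaddlePoint f g A B b u v l) {p : X × Y} (hp : p ∈ solutionSet f g A B b) :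
    f p.1 ≠ ⊤ ∧ g p.2 ≠ ⊤ ∧ ∀ u' v', f p.1 + g p.2 ≤ lagrangian f g A B b u' v' l := by
  obtain ⟨u0, hu0⟩ := hf.2
  obtain ⟨v0, hv0⟩ := hg.2
  obtain ⟨a0, ha0⟩ := hf.exists_coe hu0
  obtain ⟨c0, hc0⟩ := hg.exists_coe hv0
  have hne : f u ≠ ⊤ ∧ g v ≠ ⊤ := by
    have := hΩ.2 u0 v0
    simp only [lagrangian, ha0, hc0, ← EReal.coe_add] at this
    exact ne_top_and_ne_top_of_add_le (hf.1 u) (hg.1 v) this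
  obtain ⟨a, ha⟩ := hf.exists_coe hne.1
  obtain ⟨c, hc⟩ := hg.exists_coe hne.2
  have hfeas : A u + B v = b := by
    have := hΩ.1 (l + (A u + B v - b))
    simp only [lagrangian, ha, hc, ← EReal.coe_add, EReal.coe_le_coe_iff, inner_add_left,
      real_inner_self_eq_norm_sq] at this
    have h0 : ‖A u + B v - b‖ ^ 2 ≤ 0 := by linarith
    have h1 : ‖A u + B v - b‖ = 0 := by
      rw [← sq_eq_zero_iff]; exact le_antisymm h0 (sq_nonneg _)
    exact sub_eq_zero.1 (norm_eq_zero.1 h1)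
  have hle := hp.2 u v hfeas
  have hmin : ∀ u' v', f p.1 + g p.2 ≤ lagrangian f g A B b u' v' l := fun u' v' =>
    hle.trans ((lagrangian_of_feasible hfeas l).symm.le.trans (hΩ.2 u' v'))
  rw [ha, hc, ← EReal.coe_add, ← add_zero (f p.1 + g p.2), ← EReal.coe_zero] at hle
  have hfin := ne_top_and_ne_top_of_add_le (hf.1 _) (hg.1 _) hle
  exact ⟨hfin.1, hfin.2, hmin⟩

theorem lowerSemicontinuous_lagrangian (hf : IsProper f) (hg : IsProper g)
    (hfl : LowerSemicontinuous f) (hgl : LowerSemicontinuous g) (l : Z) :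
    LowerSemicontinuous fun z : WithLp 2 (X × Y) => lagrangian f g A B b z.fst z.snd l := by
  have h1 : Continuous fun z : WithLp 2 (X × Y) => z.fst := by fun_prop
  have h2 : Continuous fun z : WithLp 2 (X × Y) => z.snd := by fun_prop
  have h3 : Continuous fun z : WithLp 2 (X × Y) =>
      ((inner ℝ l (A z.fst + B z.snd - b) : ℝ) : EReal) :=
    continuous_coe_real_ereal.comp (by fun_prop)
  refine LowerSemicontinuous.add' (LowerSemicontinuous.add' (hfl.comp h1) (hgl.comp h2) ?_)
    h3.lowerSemicontinuous ?_
  · intro z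
    exact EReal.continuousAt_add (Or.inr (hg.1 _)) (Or.inl (hf.1 _))
  · intro z
    exact EReal.continuousAt_add (Or.inr (EReal.coe_ne_bot _)) (Or.inr (EReal.coe_ne_top _))

/-- Points whose Lagrangian value is at most `c + η` and whose constraint residual is at most `η`. -/
def approxSolutions (f : X → EReal) (g : Y → EReal) (A : X →L[ℝ] Z) (B : Y →L[ℝ] Z) (b l : Z)
    (c η : ℝ) : Set (WithLp 2 (X × Y)) :=
  {z | lagrangian f g A B b z.fst z.snd l ≤ ((c + η : ℝ) : EReal) ∧ ‖A z.fst + B z.snd - b‖ ≤ η}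

theorem isClosed_approxSolutions (hf : IsProper f) (hg : IsProper g)
    (hfl : LowerSemicontinuous f) (hgl : LowerSemicontinuous g) (l : Z) (c η : ℝ) :
    IsClosed (approxSolutions f g A B b l c η) :=
  ((lowerSemicontinuous_lagrangian hf hg hfl hgl l).isClosed_preimage _).inter
    (isClosed_le (f := fun z : WithLp 2 (X × Y) => ‖A z.fst + B z.snd - b‖) (by fun_prop)
      continuous_const)

theorem convex_approxSolutions (hf : IsProper f) (hg : IsProper g)
    (hfc : IsConvex f) (hgc : IsConvex g) (l : Z) (c η : ℝ) :
    Convex ℝ (approxSolutions f g A B b l c η) := by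
  rw [convex_iff_forall_pos]
  rintro u ⟨hu1, hu2⟩ v ⟨hv1, hv2⟩ s t hs ht hst
  have hu := ne_top_and_ne_top_of_add_le (hf.1 _) (hg.1 _) hu1
  have hv := ne_top_and_ne_top_of_add_le (hf.1 _) (hg.1 _) hv1
  obtain ⟨a1, ha1⟩ := hf.exists_coe hu.1
  obtain ⟨a2, ha2⟩ := hg.exists_coe hu.2
  obtain ⟨b1, hb1⟩ := hf.exists_coe hv.1
  obtain ⟨b2, hb2⟩ := hg.exists_coe hv.2
  have h1 := hfc u.fst v.fst s t hs ht hst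
  have h2 := hgc u.snd v.snd s t hs ht hst
  have e : A (s • u + t • v).fst + B (s • u + t • v).snd - b
      = s • (A u.fst + B u.snd - b) + t • (A v.fst + B v.snd - b) := by
    simp only [WithLp.add_fst, WithLp.smul_fst, WithLp.add_snd, WithLp.smul_snd, map_add, map_smul]
    have : b = s • b + t • b := by rw [← add_smul, hst, one_smul]
    nth_rewrite 1 [this]
    module
  constructor
  · simp only [lagrangian, ha1, ha2, hb1, hb2, ← EReal.coe_add, ← EReal.coe_mul,
      EReal.coe_le_coe_iff] at *
    rw [e]
    refine (add_le_add_left (add_le_add h1 h2) _).trans ?_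
    simp only [← EReal.coe_add, EReal.coe_le_coe_iff, inner_add_right, inner_smul_right]
    have h3 := mul_le_mul_of_nonneg_left hu1 hs.le
    have h4 := mul_le_mul_of_nonneg_left hv1 ht.le
    have h5 : c + η = s * (c + η) + t * (c + η) := by rw [← add_mul, hst, one_mul]
    rw [h5]
    linarith
  · rw [e]
    refine (norm_add_le _ _).trans ?_
    rw [norm_smul, norm_smul, Real.norm_of_nonneg hs.le, Real.norm_of_nonneg ht.le]
    have h5 : η = s * η + t * η := by rw [← add_mul, hst, one_mul]
    rw [h5]
    gcongr

/-- Points with asymptotically optimal Lagrangian value, vanishing constraint residual, and norm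
asymptotically at most that of the minimal norm solution converge to it. -/
theorem tendsto_minNormSolution [CompleteSpace X] [CompleteSpace Y]
    (hf : IsProper f) (hg : IsProper g) (hfc : IsConvex f) (hgc : IsConvex g)
    (hfl : LowerSemicontinuous f) (hgl : LowerSemicontinuous g) {us : X} {vs : Y} {ls : Z}
    (hΩ : IsSaddlePoint f g A B b us vs ls) {u : X} {v : Y}
    (hbar : IsMinNormSolution f g A B b u v) {ι : Type*} {φ : Filter ι} {x : ι → X} {y : ι → Y}
    {F : ι → ℝ}
    (hF : ∀ᶠ k in φ, lagrangian f g A B b (x k) (y k) ls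
      = (((f u).toReal + (g v).toReal + F k : ℝ) : EReal))
    (hF0 : Tendsto F φ (𝓝 0)) (hr : Tendsto (fun k => A (x k) + B (y k) - b) φ (𝓝 0))
    (hN : ∀ τ > 0, ∀ᶠ k in φ, ‖x k‖ ^ 2 + ‖y k‖ ^ 2 ≤ ‖u‖ ^ 2 + ‖v‖ ^ 2 + τ) :
    Tendsto (fun k => pair (x k) (y k)) φ (𝓝 (pair u v)) := by
  obtain ⟨hu, hv, hmin⟩ := hΩ.of_mem_solutionSet hf hg hbar.1
  obtain ⟨a, ha⟩ := hf.exists_coe hu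
  obtain ⟨c, hc⟩ := hg.exists_coe hv
  simp only at ha hc
  simp only [ha, hc, EReal.toReal_coe] at hF
  have hη : ∀ n : ℕ, (0 : ℝ) < 1 / ((n : ℝ) + 1) := fun n => Nat.one_div_pos_of_nat
  refine tendsto_min_norm_of_antitone
    (C := fun n : ℕ => approxSolutions f g A B b ls (a + c) (1 / ((n : ℝ) + 1))) ?_
    (fun n => isClosed_approxSolutions hf hg hfl hgl _ _ _)
    (fun n => convex_approxSolutions hf hg hfc hgc _ _ _) ?_ ?_ ?_ ?_
  · intro n m hnm z hz
    have h1 := Nat.one_div_le_one_div (α := ℝ) hnm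
    refine ⟨hz.1.trans ?_, hz.2.trans h1⟩
    rw [EReal.coe_le_coe_iff]
    linarith
  · intro n
    have hfe : A u + B v = b := hbar.1.1
    refine ⟨?_, ?_⟩
    · change lagrangian f g A B b u v ls ≤ _
      rw [lagrangian_of_feasible hfe, ha, hc, ← EReal.coe_add, EReal.coe_le_coe_iff]
      linarith [hη n]
    · change ‖A u + B v - b‖ ≤ _
      rw [hfe, sub_self, norm_zero]
      exact (hη n).le
  · intro q hq
    have hlim : Tendsto (fun n : ℕ => (1 : ℝ) / ((n : ℝ) + 1)) atTop (𝓝 0) :=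
      tendsto_one_div_add_atTop_nhds_zero_nat
    have hfe : A q.fst + B q.snd = b := by
      have h0 : ‖A q.fst + B q.snd - b‖ ≤ 0 := ge_of_tendsto' hlim fun n => (hq n).2
      exact sub_eq_zero.1 (norm_le_zero_iff.1 h0)
    have hval : f q.fst + g q.snd ≤ ((a + c : ℝ) : EReal) := by
      have h0 : Tendsto (fun n : ℕ => ((a + c + 1 / ((n : ℝ) + 1) : ℝ) : EReal)) atTop
          (𝓝 ((a + c + 0 : ℝ) : EReal)) :=
        (continuous_coe_real_ereal.tendsto _).comp (hlim.const_add _)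
      rw [add_zero] at h0
      exact ge_of_tendsto' h0 fun n => (lagrangian_of_feasible hfe ls).symm.le.trans (hq n).1
    refine hbar.2 (q.fst, q.snd) ⟨hfe, fun u' v' h' => hval.trans ?_⟩
    rw [EReal.coe_add, ← ha, ← hc]
    exact hbar.1.2 u' v' h'
  · intro n
    filter_upwards [hF, hF0.eventually (gt_mem_nhds (hη n)),
      hr.norm.eventually (gt_mem_nhds (norm_zero.trans_lt (hη n)))] with k h1 h2 h3
    refine ⟨?_, h3.le⟩
    change lagrangian f g A B b (x k) (y k) ls ≤ _
    rw [h1, EReal.coe_le_coe_iff]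
    linarith
  · intro τ hτ
    filter_upwards [hN τ hτ] with k hk
    rwa [norm_pair_sq, norm_pair_sq]

end Saddle

/-! ### The energy -/

section EnergyDef

variable {X Y Z : Type*}
  [NormedAddCommGroup X] [NormedAddCommGroup Y] [InnerProductSpace ℝ Y]
  [NormedAddCommGroup Z] [InnerProductSpace ℝ Z]

/-- The part of the energy that does not involve objective values: squared distances of the
extrapolated iterates `p, q` (the vectors `Vd k, Hd k` of the algorithm), of the iterates `u, v` and
of the multiplier `l` to the saddle point `(us, vs, ls)`, together with a correction for the
sequential update of the two blocks, with `c = α k * β k`. -/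
noncomputable def quadraticEnergy (B : Y →L[ℝ] Z) (γ δ : ℝ) (us : X) (vs : Y) (ls : Z) (c : ℝ)
    (u : X) (v : Y) (l : Z) (p : X) (q : Y) : ℝ :=
  1 / 2 * ‖p - us‖ ^ 2 + 1 / 2 * ‖q - vs‖ ^ 2
    + (δ * γ - 1) / 2 * (‖u - us‖ ^ 2 + ‖v - vs‖ ^ 2)
    + δ * (1 / 2 * ‖l - ls‖ ^ 2 + c ^ 2 / 2 * ‖B (q - vs)‖ ^ 2)

theorem le_quadraticEnergy {B : Y →L[ℝ] Z} {γ δ : ℝ} (hδ : 0 < δ)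
    (hδγ : 0 ≤ δ * γ - 1) (us : X) (vs : Y) (ls : Z) (c : ℝ)
    (u : X) (v : Y) (l : Z) (p : X) (q : Y) :
    δ / 2 * ‖l - ls‖ ^ 2 ≤ quadraticEnergy B γ δ us vs ls c u v l p q := by
  unfold quadraticEnergy
  have h1 : 0 ≤ (δ * γ - 1) / 2 * (‖u - us‖ ^ 2 + ‖v - vs‖ ^ 2) := by positivity
  have h2 : 0 ≤ δ * (c ^ 2 / 2 * ‖B (q - vs)‖ ^ 2) := by positivity
  linarith [sq_nonneg ‖p - us‖, sq_nonneg ‖q - vs‖]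

/-- The Lagrangian gap `L(u, v, ls) - L(us, vs, ls)` for a feasible point `(us, vs)`, as a real
number. It is meaningful where `f` and `g` are finite. -/
noncomputable def lagrangianGap [InnerProductSpace ℝ X] (f : X → EReal) (g : Y → EReal)
    (A : X →L[ℝ] Z) (B : Y →L[ℝ] Z) (b : Z) (us : X) (vs : Y) (ls : Z) (u : X) (v : Y) : ℝ :=
  (f u).toReal + (g v).toReal - ((f us).toReal + (g vs).toReal) + inner ℝ ls (A u + B v - b)

end EnergyDef

/-! ### Optimality conditions along the iteration -/

/-- The resolvent identity behind the choice of the proximal centre and of the weight `eta`: the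
proximal gradient is the velocity increment `V₁ - V₀` plus the strong convexity correction. -/
theorem smul_proximal_gradient {X : Type*} [NormedAddCommGroup X] [InnerProductSpace ℝ X]
    {γ δ μ α β : ℝ} (hγ : 0 < γ) (hδ : 0 < δ) (hμ : 0 ≤ μ) (hα : 0 < α) (hβ : 0 < β)
    {x₀ x₁ V₀ V₁ : X} (hV : V₁ = (1 / α) • (x₁ - x₀) + γ • x₁) :
    (α * β) • ((eta γ δ μ α β / (α * β)) •
        (x₁ - (x₀ + (1 / eta γ δ μ α β) • (V₀ - γ • x₀))))
      = V₁ - V₀ + (μ * δ * β) • (x₁ - x₀) := by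
  have hη : 0 < eta γ δ μ α β := by unfold eta; positivity
  rw [smul_smul, mul_div_cancel₀ _ (by positivity), sub_add_eq_sub_sub, smul_sub, smul_smul,
    mul_one_div_cancel hη.ne', one_smul, hV]
  unfold eta
  module

section Sequence

variable {X Y Z : Type*}
  [NormedAddCommGroup X] [InnerProductSpace ℝ X]
  [NormedAddCommGroup Y] [InnerProductSpace ℝ Y]
  [NormedAddCommGroup Z] [InnerProductSpace ℝ Z]
  {f : X → EReal} {g : Y → EReal} {A : X →L[ℝ] Z} {B : Y →L[ℝ] Z} {b : Z}
  {μf μg γ δ : ℝ} {α β ε : ℕ → ℝ}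
  {x : ℕ → X} {y : ℕ → Y} {lam : ℕ → Z} {V Vd : ℕ → X} {H Hd : ℕ → Y}

theorem IsSplittingSequence.Vd_succ
    (hseq : IsSplittingSequence f g A B b μf μg γ δ α β ε x y lam V Vd H Hd) {k : ℕ}
    (hk : 1 ≤ k) : Vd (k + 1) = x (k + 1) + (δ / α k) • (x (k + 1) - x k) := by
  rw [hseq.def_Vd (k + 1) (by omega), hseq.step_V k hk]
  module

theorem IsSplittingSequence.Hd_succ
    (hseq : IsSplittingSequence f g A B b μf μg γ δ α β ε x y lam V Vd H Hd) {k : ℕ}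
    (hk : 1 ≤ k) : Hd (k + 1) = y (k + 1) + (δ / α k) • (y (k + 1) - y k) := by
  rw [hseq.def_Hd (k + 1) (by omega), hseq.step_H k hk]
  module

/-- The dual update in terms of plain residuals: the right-hand side is the multiplier that appears
in the optimality condition of the second subproblem. -/
theorem IsSplittingSequence.lam_succ
    (hseq : IsSplittingSequence f g A B b μf μg γ δ α β ε x y lam V Vd H Hd) {k : ℕ}
    (hk : 1 ≤ k) (hα : 0 < α k) :
    lam (k + 1) = lam k - (δ * β k) • (A (x k) + B (y k) - b)
      + ((α k + δ) * β k) • (A (x (k + 1)) + B (y (k + 1)) - b) := by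
  rw [hseq.step_lam k hk, hseq.Vd_succ hk, hseq.Hd_succ hk]
  simp only [map_add, map_smul, map_sub]
  match_scalars <;> field_simp
  ring

/-- Optimality of the first subproblem. Since it uses the old second block, its multiplier is
`lam (k + 1)` up to the correction `(α k * β k) • B (Hd k - Hd (k + 1))`. -/
theorem IsSplittingSequence.exists_subgradient_x [CompleteSpace X] [CompleteSpace Z]
    (hseq : IsSplittingSequence f g A B b μf μg γ δ α β ε x y lam V Vd H Hd)
    (hf : IsProper f) (hfc : IsConvex f) (hγ : 0 < γ) (hδ : 0 < δ) (hμ : 0 ≤ μf) {k : ℕ}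
    (hk : 1 ≤ k) (hα : 0 < α k) (hβ : 0 < β k) :
    f (x (k + 1)) ≠ ⊤ ∧ ∃ ξ ∈ subdiff f (x (k + 1)),
      V (k + 1) - V k = -((α k * β k) • (ξ + ContinuousLinearMap.adjoint A
          (lam (k + 1) + (α k * β k) • (B (Hd k) - B (Hd (k + 1)))) + ε k • x (k + 1))
        + (μf * δ * β k) • (x (k + 1) - x k)) := by
  set l := lam k - (δ * β k) • (A (x k) + B (y k) - b) + (δ * α k * β k) • B (H k - γ • y k)
    with hl
  set w := x k + (1 / eta γ δ μf (α k) (β k)) • (V k - γ • x k) with hw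
  set κ := eta γ δ μf (α k) (β k) / (α k * β k) with hκ
  obtain ⟨h1, h2⟩ := subproblem_optimality hf hfc A (l := l) (c := B (y k) - b)
    (θ := (α k + δ) * β k) (κ := κ) (ε := ε k) (w := w) (p := x (k + 1)) (by
      intro u
      have := isMinOn_iff.1 (hseq.step_x k hk) u (Set.mem_univ _)
      have e : eta γ δ μf (α k) (β k) / (2 * α k * β k) = κ / 2 := by
        rw [hκ, div_div]; congr 1; ring
      rw [← hl, ← hw, e] at this
      simp only [augLagrangian, lagrangian, add_zero, add_sub_assoc, add_assoc,
        ← EReal.coe_add] at this ⊢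
      exact this)
  refine ⟨h1, _, h2, ?_⟩
  have hM : l + ((α k + δ) * β k) • (A (x (k + 1)) + (B (y k) - b))
      = lam (k + 1) + (α k * β k) • (B (Hd k) - B (Hd (k + 1))) := by
    rw [hseq.lam_succ hk hα, hseq.Hd_succ hk, hseq.def_Hd k hk, hl]
    simp only [map_add, map_smul, map_sub]
    match_scalars <;> field_simp <;> ring
  have hP := smul_proximal_gradient hγ hδ hμ hα hβ (V₀ := V k) (hseq.step_V k hk)
  rw [← hw, ← hκ] at hP
  rw [hM, show ∀ a c d : X, -(a + c + d) + a + d = -c by intros; abel, smul_neg, hP]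
  abel

theorem IsSplittingSequence.exists_subgradient_y [CompleteSpace Y] [CompleteSpace Z]
    (hseq : IsSplittingSequence f g A B b μf μg γ δ α β ε x y lam V Vd H Hd)
    (hg : IsProper g) (hgc : IsConvex g) (hγ : 0 < γ) (hδ : 0 < δ) (hμ : 0 ≤ μg) {k : ℕ}
    (hk : 1 ≤ k) (hα : 0 < α k) (hβ : 0 < β k) :
    g (y (k + 1)) ≠ ⊤ ∧ ∃ ζ ∈ subdiff g (y (k + 1)),
      H (k + 1) - H k = -((α k * β k) • (ζ + ContinuousLinearMap.adjoint B (lam (k + 1))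
          + ε k • y (k + 1)) + (μg * δ * β k) • (y (k + 1) - y k)) := by
  set l := lam k - (δ * β k) • (A (x k) + B (y k) - b) with hl
  set w := y k + (1 / eta γ δ μg (α k) (β k)) • (H k - γ • y k) with hw
  set κ := eta γ δ μg (α k) (β k) / (α k * β k) with hκ
  obtain ⟨h1, h2⟩ := subproblem_optimality hg hgc B (l := l) (c := A (x (k + 1)) - b)
    (θ := (α k + δ) * β k) (κ := κ) (ε := ε k) (w := w) (p := y (k + 1)) (by
      intro u
      have := isMinOn_iff.1 (hseq.step_y k hk) u (Set.mem_univ _)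
      have e : eta γ δ μg (α k) (β k) / (2 * α k * β k) = κ / 2 := by
        rw [hκ, div_div]; congr 1; ring
      rw [← hl, ← hw, e] at this
      have e' : ∀ v, B v + (A (x (k + 1)) - b) = A (x (k + 1)) + B v - b := fun v => by abel
      simp only [augLagrangian, lagrangian, zero_add, e', add_assoc, ← EReal.coe_add] at this ⊢
      exact this)
  refine ⟨h1, _, h2, ?_⟩
  have hM : l + ((α k + δ) * β k) • (B (y (k + 1)) + (A (x (k + 1)) - b)) = lam (k + 1) := by
    rw [hseq.lam_succ hk hα, hl]
    module
  have hP := smul_proximal_gradient hγ hδ hμ hα hβ (V₀ := H k) (hseq.step_H k hk)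
  rw [← hw, ← hκ] at hP
  rw [hM, show ∀ a c d : Y, -(a + c + d) + a + d = -c by intros; abel, smul_neg, hP]
  abel

/-! ### Decrease of the energy -/

/-- Energy balance of one proximal step in a single variable, tested against `xs`; the vector `m`
is the dual contribution. -/
theorem primal_energy_step {E : Type*} [NormedAddCommGroup E] [InnerProductSpace ℝ E]
    {γ δ μ α β ε f₀ f₁ fs : ℝ} (hδ : 0 < δ) (hδγ : 0 ≤ δ * γ - 1) (hμ : 0 ≤ μ) (hα : 0 < α)
    (hβ : 0 < β) (hε : 0 ≤ ε) {x₀ x₁ xs V₀ V₁ S₀ S₁ ξ m : E}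
    (hS₀ : S₀ = δ • V₀ + (1 - δ * γ) • x₀ - xs) (hS₁ : S₁ = δ • V₁ + (1 - δ * γ) • x₁ - xs)
    (hS₁' : S₁ = x₁ + (δ / α) • (x₁ - x₀) - xs)
    (hV : V₁ - V₀ = -((α * β) • (ξ + m + ε • x₁) + (μ * δ * β) • (x₁ - x₀)))
    (hs : f₁ + inner ℝ ξ (xs - x₁) + μ / 2 * ‖xs - x₁‖ ^ 2 ≤ fs)
    (h0 : f₁ + inner ℝ ξ (x₀ - x₁) + μ / 2 * ‖x₀ - x₁‖ ^ 2 ≤ f₀) :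
    1 / 2 * ‖S₁‖ ^ 2 + (δ * γ - 1) / 2 * ‖x₁ - xs‖ ^ 2 + δ * (α * β) * inner ℝ m S₁
        + δ * (α * β) * (f₁ - fs + ε / 2 * (‖x₁‖ ^ 2 - ‖xs‖ ^ 2))
        + δ ^ 2 * β * (f₁ - f₀ + ε / 2 * (‖x₁‖ ^ 2 - ‖x₀‖ ^ 2))
        + δ * (α * β) * μ / 2 * ‖S₁‖ ^ 2
      ≤ 1 / 2 * ‖S₀‖ ^ 2 + (δ * γ - 1) / 2 * ‖x₀ - xs‖ ^ 2 := by
  obtain ⟨p, rfl⟩ : ∃ p, xs = x₁ - p := ⟨x₁ - xs, by abel⟩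
  obtain ⟨d, rfl⟩ : ∃ d, x₀ = x₁ - d := ⟨x₁ - x₀, by abel⟩
  -- Writing `δ = α * e` makes all coefficients polynomial.
  obtain ⟨e, rfl⟩ : ∃ e, δ = α * e := ⟨δ / α, by field_simp⟩
  have he : 0 < e := pos_of_mul_pos_right hδ hα.le
  rw [mul_div_cancel_left₀ _ hα.ne'] at hS₁'
  have hS₁p : S₁ = p + e • d := by rw [hS₁']; module
  have hw : S₀ = S₁ + ((α * e * (α * β)) • (ξ + m + ε • x₁)
      + (μ * (α * e) ^ 2 * β + (α * e * γ - 1)) • d) := by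
    have : V₀ = V₁ + ((α * β) • (ξ + m + ε • x₁) + (μ * (α * e) * β) • (x₁ - (x₁ - d))) := by
      rw [← sub_eq_iff_eq_add', ← neg_sub, hV, neg_neg]
    rw [hS₀, hS₁, this]
    module
  have hn : ‖S₁‖ ^ 2 + 2 * inner ℝ ((α * e * (α * β)) • (ξ + m + ε • x₁)
      + (μ * (α * e) ^ 2 * β + (α * e * γ - 1)) • d) S₁ ≤ ‖S₀‖ ^ 2 := by
    rw [hw, norm_add_sq_real, real_inner_comm]
    exact le_add_of_nonneg_right (sq_nonneg _)
  have hs' := mul_le_mul_of_nonneg_left hs (by positivity : 0 ≤ α * e * (α * β))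
  have h0' := mul_le_mul_of_nonneg_left h0 (by positivity : 0 ≤ (α * e) ^ 2 * β)
  have n1 : 0 ≤ ε * (α * e * (α * β)) * ‖p‖ ^ 2 := by positivity
  have n2 : 0 ≤ ε * ((α * e) ^ 2 * β) * ‖d‖ ^ 2 := by positivity
  have n3 : 0 ≤ μ * ((α * e) ^ 2 * β) * ‖d‖ ^ 2 := by positivity
  have n4 : 0 ≤ μ * ((α * e) ^ 2 * β) * e * ‖d‖ ^ 2 := by positivity
  have n5 : 0 ≤ (α * e * γ - 1) * ‖d‖ ^ 2 := by positivity
  have n6 : 0 ≤ (α * e * γ - 1) * e * ‖d‖ ^ 2 := by positivity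
  rw [hS₁p] at hn ⊢
  simp only [sub_sub_cancel, sub_sub_cancel_left, inner_neg_right, norm_neg, norm_add_sq_real,
    norm_sub_sq_real, inner_add_left, inner_add_right, inner_smul_left, inner_smul_right,
    norm_smul, mul_pow, Real.norm_eq_abs, sq_abs, RCLike.conj_to_real, real_inner_self_eq_norm_sq,
    show x₁ - d - (x₁ - p) = p - d by abel] at hn hs' h0' ⊢
  rw [real_inner_comm p d] at hn
  linarith

/-- Energy balance of the dual step. The mixed term `c ^ 2 * ⟪b₀ - b₁, a⟫`, caused by updating the
two primal variables one after the other, telescopes up to the square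
`c ^ 2 / 2 * ‖a + b₀‖ ^ 2`. -/
theorem dual_energy_step {E : Type*} [NormedAddCommGroup E] [InnerProductSpace ℝ E]
    {c : ℝ} {l₀ l₁ ls a b₀ b₁ : E} (hl : l₁ = l₀ + c • (a + b₁)) :
    1 / 2 * ‖l₁ - ls‖ ^ 2 + c ^ 2 / 2 * ‖b₁‖ ^ 2
      ≤ 1 / 2 * ‖l₀ - ls‖ ^ 2 + c ^ 2 / 2 * ‖b₀‖ ^ 2 + c * inner ℝ (l₁ - ls) (a + b₁)
        + c ^ 2 * inner ℝ (b₀ - b₁) a := by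
  have h := mul_nonneg (sq_nonneg c) (sq_nonneg ‖a + b₀‖)
  obtain ⟨p, hp⟩ : ∃ p, p = l₁ - ls := ⟨_, rfl⟩
  have h0 : l₀ - ls = p - c • (a + b₁) := by rw [hp, hl]; abel
  rw [h0, ← hp]
  simp only [norm_add_sq_real, norm_sub_sq_real, inner_add_right, inner_sub_left,
    inner_smul_right, norm_smul, mul_pow, Real.norm_eq_abs, sq_abs] at h ⊢
  rw [real_inner_comm a b₀, real_inner_comm a b₁]
  linarith

/-- One step of the algorithm decreases the energy, up to the Tikhonov terms. The growth of the
weight `α * β` of the sequential correction is paid for by the strong convexity of `g`. -/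
theorem IsSplittingSequence.energy_step [CompleteSpace X] [CompleteSpace Y] [CompleteSpace Z]
    (hseq : IsSplittingSequence f g A B b μf μg γ δ α β ε x y lam V Vd H Hd)
    (hf : StrongClass μf f) (hg : StrongClass μg g) (hμf : 0 ≤ μf) (hμg : 0 ≤ μg)
    (hγ : 0 < γ) (hδ : 0 < δ) (hδγ : 0 ≤ δ * γ - 1)
    {us : X} {vs : Y} (ls : Z) (hus : f us ≠ ⊤) (hvs : g vs ≠ ⊤) (hfeas : A us + B vs = b) {k : ℕ}
    (hk : 1 ≤ k) (hα : 0 < α k) (hβ : 0 < β k) (hε : 0 ≤ ε k)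
    (hB : ‖B‖ ^ 2 * (α (k + 1) ^ 2 * β (k + 1) ^ 2 - α k ^ 2 * β k ^ 2) ≤ α k * β k * μg)
    (hfx : f (x k) ≠ ⊤) (hgy : g (y k) ≠ ⊤) :
    quadraticEnergy B γ δ us vs ls (α (k + 1) * β (k + 1)) (x (k + 1)) (y (k + 1)) (lam (k + 1))
        (Vd (k + 1)) (Hd (k + 1))
      + (δ * (α k * β k) + δ ^ 2 * β k)
        * (lagrangianGap f g A B b us vs ls (x (k + 1)) (y (k + 1))
          + ε k / 2 * (‖x (k + 1)‖ ^ 2 + ‖y (k + 1)‖ ^ 2 - (‖us‖ ^ 2 + ‖vs‖ ^ 2)))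
    ≤ quadraticEnergy B γ δ us vs ls (α k * β k) (x k) (y k) (lam k) (Vd k) (Hd k)
      + δ ^ 2 * β k
        * (lagrangianGap f g A B b us vs ls (x k) (y k)
          + ε k / 2 * (‖x k‖ ^ 2 + ‖y k‖ ^ 2 - (‖us‖ ^ 2 + ‖vs‖ ^ 2))) := by
  obtain ⟨hfx', ξ, hξ, hVx⟩ :=
    hseq.exists_subgradient_x hf.proper hf.convex hγ hδ hμf hk hα hβ
  obtain ⟨hgy', ζ, hζ, hVy⟩ :=
    hseq.exists_subgradient_y hg.proper hg.convex hγ hδ hμg hk hα hβ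
  have hx := primal_energy_step (S₀ := Vd k - us) (S₁ := Vd (k + 1) - us) hδ hδγ hμf hα hβ hε
    (by rw [hseq.def_Vd k hk]) (by rw [hseq.def_Vd (k + 1) (by omega)])
    (by rw [hseq.Vd_succ hk]) hVx (hf.toReal_le hξ hfx' hus) (hf.toReal_le hξ hfx' hfx)
  have hy := primal_energy_step (S₀ := Hd k - vs) (S₁ := Hd (k + 1) - vs) hδ hδγ hμg hα hβ hε
    (by rw [hseq.def_Hd k hk]) (by rw [hseq.def_Hd (k + 1) (by omega)])
    (by rw [hseq.Hd_succ hk]) hVy (hg.toReal_le hζ hgy' hvs) (hg.toReal_le hζ hgy' hgy)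
  have hl := dual_energy_step (c := α k * β k) (l₀ := lam k) (l₁ := lam (k + 1)) (ls := ls)
    (a := A (Vd (k + 1) - us)) (b₀ := B (Hd k - vs)) (b₁ := B (Hd (k + 1) - vs))
    (by rw [hseq.step_lam k hk, ← hfeas]; simp only [map_sub]; congr 2; abel)
  have hl' := mul_le_mul_of_nonneg_left hl hδ.le
  -- The growth of the weight of the sequential correction is absorbed by the strong convexity.
  have hcorr : δ * ((α (k + 1) * β (k + 1)) ^ 2 / 2 * ‖B (Hd (k + 1) - vs)‖ ^ 2)
      ≤ δ * ((α k * β k) ^ 2 / 2 * ‖B (Hd (k + 1) - vs)‖ ^ 2)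
        + δ * (α k * β k) * μg / 2 * ‖Hd (k + 1) - vs‖ ^ 2 := by
    have hBT : ‖B (Hd (k + 1) - vs)‖ ^ 2 ≤ ‖B‖ ^ 2 * ‖Hd (k + 1) - vs‖ ^ 2 := by
      rw [← mul_pow]
      exact pow_le_pow_left₀ (norm_nonneg _) (B.le_opNorm _) 2
    have h1 : ((α (k + 1) * β (k + 1)) ^ 2 - (α k * β k) ^ 2) * ‖B (Hd (k + 1) - vs)‖ ^ 2
        ≤ α k * β k * μg * ‖Hd (k + 1) - vs‖ ^ 2 := by
      rcases le_total ((α (k + 1) * β (k + 1)) ^ 2) ((α k * β k) ^ 2) with h | h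
      · exact (mul_nonpos_of_nonpos_of_nonneg (sub_nonpos.2 h) (sq_nonneg _)).trans
          (by positivity)
      · refine (mul_le_mul_of_nonneg_left hBT (sub_nonneg.2 h)).trans ?_
        have h2 := mul_le_mul_of_nonneg_right hB (sq_nonneg ‖Hd (k + 1) - vs‖)
        linarith
    have h2 := mul_le_mul_of_nonneg_left h1 hδ.le
    linarith
  have hnn : 0 ≤ δ * (α k * β k) * μf / 2 * ‖Vd (k + 1) - us‖ ^ 2 := by positivity
  -- The extrapolated residual is a combination of consecutive plain residuals.
  have hres : α k * (inner ℝ ls (A (Vd (k + 1) - us) + B (Hd (k + 1) - vs)))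
      = α k * inner ℝ ls (A (x (k + 1)) + B (y (k + 1)) - b)
        + δ * (inner ℝ ls (A (x (k + 1)) + B (y (k + 1)) - b)
          - inner ℝ ls (A (x k) + B (y k) - b)) := by
    have e : α k • (A (Vd (k + 1) - us) + B (Hd (k + 1) - vs))
        = α k • (A (x (k + 1)) + B (y (k + 1)) - b)
          + δ • ((A (x (k + 1)) + B (y (k + 1)) - b) - (A (x k) + B (y k) - b)) := by
      rw [hseq.Vd_succ hk, hseq.Hd_succ hk, ← hfeas]
      simp only [map_add, map_smul, map_sub]
      match_scalars <;> field_simp <;> ring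
    rw [← inner_smul_right, e, inner_add_right, inner_smul_right, inner_smul_right,
      inner_sub_right ls (A (x (k + 1)) + B (y (k + 1)) - b)]
  have hres' := congrArg (fun s => δ * β k * s) hres
  simp only [ContinuousLinearMap.adjoint_inner_left, inner_add_left, inner_smul_left,
    RCLike.conj_to_real] at hx hy
  have e1 : B (Hd k - vs) - B (Hd (k + 1) - vs) = B (Hd k) - B (Hd (k + 1)) := by
    simp only [map_sub]; abel
  rw [e1, inner_sub_left, inner_add_right (lam (k + 1))] at hl'
  unfold quadraticEnergy lagrangianGap
  linarith

end Sequence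

/-! ### Consequences of the energy decrease -/

section Scalar

variable {Q F N α β ε : ℕ → ℝ} {δ Ns : ℝ}

/-- The energy is `o(β)`. After moving the constant `Ns` to the right-hand side, the energy with
Tikhonov term `ε / 2 * N` grows by at most `δ * Ns / 2 * (α * ε) * β` per step. -/
theorem energy_div_tendsto_zero (hδ : 0 < δ) (hα : ∀ k, 0 < α k) (hβ0 : ∀ k, 0 < β k)
    (hβm : Monotone β) (hβ : Tendsto β atTop atTop)
    (hgrow : ∀ k, δ * β (k + 1) ≤ δ * β k + α k * β k) (hε0 : ∀ k, 0 < ε k)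
    (hεm : ∀ k, ε (k + 1) ≤ ε k) (hsum : Summable fun k => α k * ε k)
    (hQ : ∀ k, 0 ≤ Q k) (hF : ∀ k, 0 ≤ F k) (hN : ∀ k, 0 ≤ N k) (hNs : 0 ≤ Ns)
    (hstep : ∀ k, Q (k + 1) + (δ * (α k * β k) + δ ^ 2 * β k)
        * (F (k + 1) + ε k / 2 * (N (k + 1) - Ns))
      ≤ Q k + δ ^ 2 * β k * (F k + ε k / 2 * (N k - Ns))) :
    Tendsto (fun k => (Q k + δ ^ 2 * β k * F k) / β k) atTop (𝓝 0) := by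
  have hpos : ∀ k, 0 ≤ δ ^ 2 * β k * (ε k / 2 * N k) := fun k => by
    have := hβ0 k; have := hε0 k; have := hN k; positivity
  have hpos' : ∀ k, 0 ≤ Q k + δ ^ 2 * β k * F k := fun k => by
    have := hβ0 k; have := hQ k; have := hF k; positivity
  have hlim := tendsto_div_zero_of_add_le (a := fun k => δ * Ns / 2 * (α k * ε k)) (β := β)
    (e := fun k => Q k + δ ^ 2 * β k * F k + δ ^ 2 * β k * (ε k / 2 * N k))
    (fun k => by have := hα k; have := hε0 k; positivity) (hsum.mul_left _) hβ0 hβm hβ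
    (fun k => add_nonneg (hpos' k) (hpos k)) (fun k => by
      have h1 : δ ^ 2 * β (k + 1) * (F (k + 1) + ε (k + 1) / 2 * N (k + 1))
          ≤ (δ * (α k * β k) + δ ^ 2 * β k) * (F (k + 1) + ε k / 2 * N (k + 1)) := by
        have h2 := mul_le_mul_of_nonneg_left (hgrow k) hδ.le
        have h3 := hβ0 (k + 1)
        have h4 := hF (k + 1)
        have h5 := hN (k + 1)
        have h6 := hε0 k
        exact mul_le_mul (by linarith) (by gcongr; exact hεm k)
          (by have := hε0 (k + 1); positivity) (le_trans (by positivity) h2 |>.trans (by linarith))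
      have := hstep k
      linarith)
  refine squeeze_zero (fun k => div_nonneg (hpos' k) (hβ0 k).le) (fun k => ?_) hlim
  exact div_le_div_of_nonneg_right (le_add_of_nonneg_right (hpos k)) (hβ0 k).le

/-- If the squared norms `N` eventually stay above the minimal one `Ns`, then the full energy is
eventually nonincreasing, hence bounded, and its Tikhonov part forces `N` down to `Ns`. -/
theorem norm_sq_upper_bound_of_outside (hδ : 0 < δ) (hβ0 : ∀ k, 0 < β k)
    (hgrow : ∀ k, δ * β (k + 1) ≤ δ * β k + α k * β k) (hε0 : ∀ k, 0 < ε k)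
    (hεm : ∀ k, ε (k + 1) ≤ ε k) (hlim : Tendsto (fun k => β k * ε k) atTop atTop)
    (hQ : ∀ k, 0 ≤ Q k) (hF : ∀ k, 0 ≤ F k) (hout : ∀ᶠ k in atTop, Ns ≤ N k)
    (hstep : ∀ k, Q (k + 1) + (δ * (α k * β k) + δ ^ 2 * β k)
        * (F (k + 1) + ε k / 2 * (N (k + 1) - Ns))
      ≤ Q k + δ ^ 2 * β k * (F k + ε k / 2 * (N k - Ns))) {τ : ℝ} (hτ : 0 < τ) :
    ∀ᶠ k in atTop, N k ≤ Ns + τ := by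
  obtain ⟨K, hK⟩ := eventually_atTop.1 hout
  set G : ℕ → ℝ := fun k => Q k + δ ^ 2 * β k * (F k + ε k / 2 * (N k - Ns)) with hG
  have hGK : ∀ k, K ≤ k → G k ≤ G K := by
    intro k hk
    induction k, hk using Nat.le_induction with
    | base => exact le_rfl
    | succ k hk ih =>
      refine le_trans ?_ ih
      refine le_trans ?_ (hstep k)
      have h0 : 0 ≤ N (k + 1) - Ns := sub_nonneg.2 (hK _ (by omega))
      have h2 := mul_le_mul_of_nonneg_left (hgrow k) hδ.le
      have h3 := hβ0 (k + 1)
      have h4 := hF (k + 1)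
      have h6 := hε0 (k + 1)
      refine add_le_add le_rfl (mul_le_mul (by linarith) (by gcongr; exact hεm k) (by positivity)
        (le_trans (by positivity) h2 |>.trans (by linarith)))
  filter_upwards [hlim.eventually_ge_atTop (2 * G K / (δ ^ 2 * τ)), eventually_ge_atTop K]
    with k hk hkK
  have h1 := hGK k hkK
  have h3 := hβ0 k
  have h4 : 0 < β k * ε k := mul_pos h3 (hε0 k)
  have h5 : 0 ≤ δ ^ 2 * β k * F k := by have := hF k; positivity
  rw [div_le_iff₀ (by positivity)] at hk
  have h6 : δ ^ 2 * (β k * ε k) * (N k - Ns) ≤ δ ^ 2 * (β k * ε k) * τ := by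
    have := hQ k
    simp only [hG] at h1 hk
    linarith
  have := le_of_mul_le_mul_left h6 (by positivity)
  linarith

end Scalar

theorem pos_of_antitone_of_tendsto {β ε : ℕ → ℝ} (hβ : ∀ k, 1 ≤ k → 0 < β k)
    (hε : ∀ k, 1 ≤ k → ε (k + 1) ≤ ε k) (hlim : Tendsto (fun k => β k * ε k) atTop atTop)
    {k : ℕ} (hk : 1 ≤ k) : 0 < ε k := by
  obtain ⟨m, hm, hkm⟩ := ((hlim.eventually_gt_atTop 0).and (eventually_ge_atTop k)).exists
  have h1 : 0 < ε m := pos_of_mul_pos_right hm (hβ m (hk.trans hkm)).le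
  have h2 : ε m ≤ ε k := by
    clear hm h1
    induction m, hkm using Nat.le_induction with
    | base => exact le_rfl
    | succ m hm ih => exact (hε m (hk.trans hm)).trans ih
  exact h1.trans_le h2

end PrimalDual

open PrimalDual in
theorem theorem4p3 {X Y Z : Type*}
    [NormedAddCommGroup X] [InnerProductSpace ℝ X] [CompleteSpace X]
    [NormedAddCommGroup Y] [InnerProductSpace ℝ Y] [CompleteSpace Y]
    [NormedAddCommGroup Z] [InnerProductSpace ℝ Z] [CompleteSpace Z]
    (f : X → EReal) (g : Y → EReal) (A : X →L[ℝ] Z) (B : Y →L[ℝ] Z) (b : Z)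
    (μf μg γ δ : ℝ) (α β ε : ℕ → ℝ)
    (hμf : 0 ≤ μf) (hμg : 0 ≤ μg)
    (hf : PrimalDual.StrongClass μf f) (hg : PrimalDual.StrongClass μg g)
    (hγ : 0 < γ) (hδ : 0 < δ) (hδγ : 0 ≤ δ * γ - 1)
    (hα : ∀ k : ℕ, 1 ≤ k → 0 < α k)
    (hβ : ∀ k : ℕ, 1 ≤ k → 0 < β k)
    (hβ_mono : ∀ k : ℕ, 1 ≤ k → β k ≤ β (k + 1))
    (hβ_lim : Tendsto β atTop atTop)
    (hβ_growth : ∀ k : ℕ, 1 ≤ k → δ * β (k + 1) ≤ δ * β k + α k * β k)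
    (hB : ∀ k : ℕ, 1 ≤ k →
      ‖B‖ ^ 2 * (α (k + 1) ^ 2 * β (k + 1) ^ 2 - α k ^ 2 * β k ^ 2) ≤ α k * β k * μg)
    (hε_anti : ∀ k : ℕ, 1 ≤ k → ε (k + 1) ≤ ε k)
    (hε_sum : Summable (fun k : ℕ => α (k + 1) * ε (k + 1)))
    (hε_lim : Tendsto (fun k : ℕ => β k * ε k) atTop atTop)
    (x : ℕ → X) (y : ℕ → Y) (lam : ℕ → Z) (V Vd : ℕ → X) (H Hd : ℕ → Y)
    (hseq : PrimalDual.IsSplittingSequence f g A B b μf μg γ δ α β ε x y lam V Vd H Hd)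
    (xs : X) (ys : Y) (ls : Z) (hΩ : PrimalDual.IsSaddlePoint f g A B b xs ys ls)
    (xbar : X) (ybar : Y) (hbar : PrimalDual.IsMinNormSolution f g A B b xbar ybar) :
    liminf (fun k : ℕ =>
        ((‖PrimalDual.pair (x k) (y k) - PrimalDual.pair xbar ybar‖ : ℝ) : EReal)) atTop = 0 ∧
    ((∃ K : ℕ, 1 ≤ K ∧
        ((∀ k : ℕ, K ≤ k → PrimalDual.pair (x k) (y k) ∈
            Metric.ball (0 : WithLp 2 (X × Y)) (√(‖xbar‖ ^ 2 + ‖ybar‖ ^ 2))) ∨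
         (∀ k : ℕ, K ≤ k → PrimalDual.pair (x k) (y k) ∈
            (Metric.ball (0 : WithLp 2 (X × Y)) (√(‖xbar‖ ^ 2 + ‖ybar‖ ^ 2)))ᶜ))) →
      Tendsto (fun k : ℕ => ‖PrimalDual.pair (x k) (y k) - PrimalDual.pair xbar ybar‖)
        atTop (𝓝 0)) := by
  have hεpos : ∀ k, 1 ≤ k → 0 < ε k := fun k hk =>
    pos_of_antitone_of_tendsto hβ hε_anti hε_lim hk
  obtain ⟨hfbar, hgbar, hmin⟩ := hΩ.of_mem_solutionSet hf.proper hg.proper hbar.1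
  have hfeas : A xbar + B ybar = b := hbar.1.1
  -- The starting point may lie outside the domains, so objective values are used from index 2 on.
  have hfx : ∀ k, f (x (k + 2)) ≠ ⊤ := fun k =>
    (hseq.exists_subgradient_x hf.proper hf.convex hγ hδ hμf (k := k + 1) (by omega)
      (hα _ (by omega)) (hβ _ (by omega))).1
  have hgy : ∀ k, g (y (k + 2)) ≠ ⊤ := fun k =>
    (hseq.exists_subgradient_y hg.proper hg.convex hγ hδ hμg (k := k + 1) (by omega)
      (hα _ (by omega)) (hβ _ (by omega))).1
  set F : ℕ → ℝ := fun k => lagrangianGap f g A B b xbar ybar ls (x (k + 2)) (y (k + 2)) with hFdef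
  set Q : ℕ → ℝ := fun k => quadraticEnergy B γ δ xbar ybar ls (α (k + 2) * β (k + 2))
    (x (k + 2)) (y (k + 2)) (lam (k + 2)) (Vd (k + 2)) (Hd (k + 2)) with hQdef
  set N : ℕ → ℝ := fun k => ‖x (k + 2)‖ ^ 2 + ‖y (k + 2)‖ ^ 2 with hNdef
  set Ns : ℝ := ‖xbar‖ ^ 2 + ‖ybar‖ ^ 2 with hNs
  have hLag : ∀ k, lagrangian f g A B b (x (k + 2)) (y (k + 2)) ls
      = (((f xbar).toReal + (g ybar).toReal + F k : ℝ) : EReal) := by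
    intro k
    obtain ⟨p, hp⟩ := hf.proper.exists_coe (hfx k)
    obtain ⟨q, hq⟩ := hg.proper.exists_coe (hgy k)
    simp only [hFdef, lagrangian, lagrangianGap, hp, hq, EReal.toReal_coe, ← EReal.coe_add]
    congr 1
    ring
  have hF : ∀ k, 0 ≤ F k := by
    intro k
    have h := hmin (x (k + 2)) (y (k + 2))
    rw [hLag, ← EReal.coe_toReal hfbar (hf.proper.1 _), ← EReal.coe_toReal hgbar (hg.proper.1 _),
      ← EReal.coe_add, EReal.coe_le_coe_iff] at h
    simpa using h
  have hQl : ∀ k, δ / 2 * ‖lam (k + 2) - ls‖ ^ 2 ≤ Q k := fun k =>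
    le_quadraticEnergy hδ hδγ _ _ _ _ _ _ _ _ _
  have hQ : ∀ k, 0 ≤ Q k := fun k => le_trans (by positivity) (hQl k)
  have hstep : ∀ k, Q (k + 1) + (δ * (α (k + 2) * β (k + 2)) + δ ^ 2 * β (k + 2))
        * (F (k + 1) + ε (k + 2) / 2 * (N (k + 1) - Ns))
      ≤ Q k + δ ^ 2 * β (k + 2) * (F k + ε (k + 2) / 2 * (N k - Ns)) := fun k =>
    hseq.energy_step hf hg hμf hμg hγ hδ hδγ ls hfbar hgbar hfeas (k := k + 2) (by omega)
      (hα _ (by omega)) (hβ _ (by omega)) (hεpos _ (by omega)).le (hB _ (by omega)) (hfx k) (hgy k)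
  have hα' : ∀ k, 0 < α (k + 2) := fun k => hα _ (by omega)
  have hβ' : ∀ k, 0 < β (k + 2) := fun k => hβ _ (by omega)
  have hε' : ∀ k, 0 < ε (k + 2) := fun k => hεpos _ (by omega)
  have hβm' : Monotone fun k => β (k + 2) := monotone_nat_of_le_succ fun k => hβ_mono _ (by omega)
  have hβl' : Tendsto (fun k => β (k + 2)) atTop atTop := hβ_lim.comp (tendsto_add_atTop_nat 2)
  have hgrow' : ∀ k, δ * β (k + 1 + 2) ≤ δ * β (k + 2) + α (k + 2) * β (k + 2) := fun k =>
    hβ_growth (k + 2) (by omega)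
  have hεm' : ∀ k, ε (k + 1 + 2) ≤ ε (k + 2) := fun k => hε_anti (k + 2) (by omega)
  have hE : Tendsto (fun k => (Q k + δ ^ 2 * β (k + 2) * F k) / β (k + 2)) atTop (𝓝 0) :=
    energy_div_tendsto_zero hδ hα' hβ' hβm' hβl' hgrow' hε' hεm'
      ((summable_nat_add_iff 1).2 hε_sum) hQ hF (fun k => by positivity) (by positivity) hstep
  have hF0 : Tendsto F atTop (𝓝 0) := by
    have h := hE.const_mul (1 / δ ^ 2)
    rw [mul_zero] at h
    refine squeeze_zero hF (fun k => ?_) h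
    have h1 := hβ' k
    calc F k = 1 / δ ^ 2 * ((0 + δ ^ 2 * β (k + 2) * F k) / β (k + 2)) := by field_simp; ring
      _ ≤ _ := by gcongr; exact hQ k
  have hr : Tendsto (fun k => A (x (k + 2)) + B (y (k + 2)) - b) atTop (𝓝 0) := by
    obtain ⟨M, hM⟩ := hE.bddAbove_range
    have hM' : ∀ k, ‖lam (k + 2) - ls‖ ≤ √(2 * M / δ) * √(β (k + 2)) := by
      intro k
      have h1 := hβ' k
      have h2 : (Q k + δ ^ 2 * β (k + 2) * F k) / β (k + 2) ≤ M := hM ⟨k, rfl⟩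
      rw [div_le_iff₀ h1] at h2
      have h3 : 0 ≤ δ ^ 2 * β (k + 2) * F k := by have := hF k; positivity
      rw [← Real.sqrt_mul' _ h1.le]
      refine Real.le_sqrt_of_sq_le ?_
      rw [div_mul_eq_mul_div, le_div_iff₀ hδ]
      linarith [hQl k]
    refine tendsto_residual (l := fun k => lam (k + 2) - ls) hδ hα' hβ' hβm' hβl' hgrow' hM'
      fun k => ?_
    have := hseq.lam_succ (k := k + 2) (by omega) (hα' k)
    rw [show k + 1 + 2 = k + 2 + 1 by ring, this]
    abel
  -- Any family of late iterates with asymptotically small norm converges.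
  have hconv : ∀ φ : Filter ℕ, φ ≤ atTop → (∀ τ > 0, ∀ᶠ k in φ, N k ≤ Ns + τ) →
      Tendsto (fun k => ‖pair (x (k + 2)) (y (k + 2)) - pair xbar ybar‖) φ (𝓝 0) := by
    intro φ hφ hN
    rw [← tendsto_iff_norm_sub_tendsto_zero]
    exact tendsto_minNormSolution hf.proper hg.proper hf.convex hg.convex hf.lsc hg.lsc hΩ hbar
      (Eventually.of_forall hLag) (hF0.mono_left hφ) (hr.mono_left hφ) hN
  have hout : (∀ᶠ k in atTop, Ns ≤ N k) →
      Tendsto (fun k => ‖pair (x (k + 2)) (y (k + 2)) - pair xbar ybar‖) atTop (𝓝 0) := fun h =>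
    hconv _ le_rfl fun τ hτ => norm_sq_upper_bound_of_outside (α := fun k => α (k + 2))
      (β := fun k => β (k + 2)) (ε := fun k => ε (k + 2)) hδ hβ' hgrow' hε' hεm'
      (hε_lim.comp (tendsto_add_atTop_nat 2)) hQ hF h hstep hτ
  have hball : ∀ k, pair (x (k + 2)) (y (k + 2)) ∈ Metric.ball (0 : WithLp 2 (X × Y)) (√Ns)
      ↔ N k < Ns := fun k => by
    rw [mem_ball_zero_iff, Real.lt_sqrt (norm_nonneg _), norm_pair_sq]
  constructor
  · refine le_antisymm ?_ (le_liminf_of_le (h := Eventually.of_forall fun k =>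
      EReal.coe_nonneg.2 (norm_nonneg _)))
    -- Convergence along a proper filter suffices.
    have hlim : ∃ φ : Filter ℕ, φ.NeBot ∧ φ ≤ atTop ∧
        Tendsto (fun k => ‖pair (x (k + 2)) (y (k + 2)) - pair xbar ybar‖) φ (𝓝 0) := by
      by_cases h : ∀ᶠ k in atTop, Ns ≤ N k
      · exact ⟨atTop, inferInstance, le_rfl, hout h⟩
      · have h' : ∃ᶠ k in atTop, N k < Ns := by simpa using not_eventually.1 h
        refine ⟨atTop ⊓ 𝓟 {k | N k < Ns}, frequently_mem_iff_neBot.1 h', inf_le_left, ?_⟩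
        refine hconv _ inf_le_left fun τ hτ => ?_
        filter_upwards [mem_inf_of_right (mem_principal_self _)] with k hk
        exact (lt_add_of_lt_of_pos hk hτ).le
    obtain ⟨φ, hne, hφ, ht⟩ := hlim
    rw [← Filter.liminf_nat_add _ 2]
    refine (liminf_le_liminf_of_le hφ).trans ?_
    exact ((continuous_coe_real_ereal.tendsto 0).comp ht).liminf_eq.le
  · rintro ⟨K, -, hK⟩
    rw [← tendsto_add_atTop_iff_nat 2]
    rcases hK with hK | hK
    · refine hconv _ le_rfl fun τ hτ => ?_
      filter_upwards [eventually_ge_atTop K] with k hk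
      exact (lt_add_of_lt_of_pos ((hball k).1 (hK (k + 2) (by omega))) hτ).le
    · refine hout ?_
      filter_upwards [eventually_ge_atTop K] with k hk
      exact not_lt.1 fun h => hK (k + 2) (by omega) ((hball k).2 h)
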